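/- Let $C=\Gamma\backslash\mathbb H$ be a hyperbolic Riemann surface of finite area, where $\Gamma$ is a discrete group of Möbius transformations acting freely on the upper half-plane $\mathbb H$, so that $\Gamma=\pi_1(C)$. Equip $C$ with the metric $\frac{dx^2+dy^2}{4y^2}$ of constant curvature $-4$, and let $g_t$ be the unit speed geodesic flow on the unit tangent bundle $T^1C$ and $\mu$ its invariant (normalised Liouville) probability measure. Let $\mathbb V$ be the flat bundle over $C$ defined by a representation $\rho:\Gamma\to \mathrm{GL}(V)$ on a finite-dimensional complex vector space $V$. Choose any norm on $V$ and any Dirichlet fundamental domain $F$ for $\Gamma$ in $\mathbb H$ (with a measurable choice of boundary points, so that $F$ meets each $\Gamma$-orbit exactly once), and let $\|\cdot\|_{\rm const}$ be the norm on $\mathbb V$ obtained by extending the norm on $V$ by parallel transport over $F$. For $x\in T^1C$ and $t\in\mathbb R$ let $A(x,t):\mathbb V_x\to\mathbb V_{g_t x}$ be the parallel transport along the geodesic from $x$ to $g_t x$, and let $\|A(x,t)\|_{\rm const}$ be its operator norm. Suppose that for some cusp of $C$ the monodromy $\rho(\gamma)$, where $\gamma\in\Gamma$ represents a simple loop around this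 cusp, has an eigenvalue of absolute value different from one. Then the flat bundle $\mathbb V$ with the norm $\|\cdot\|_{\rm const}$ is not integrable over the geodesic flow, i.e. $$\int_{T^1C}\ \sup_{t\in[-1,1]}\log^+\|A(x,t)\|_{\rm const}\,d\mu(x)=\infty .$$ -/

import Mathlib

open MeasureTheory
open scoped UpperHalfPlane MatrixGroups ENNReal

noncomputable section

namespace GeodesicCocycle

/-! ### The unit tangent bundle of the upper half-plane and its geodesic flow -/

/-- The unit tangent bundle of `ℍ` for the metric `|dz|² / (4 (Im z)²)` of constant curvature
`-4`: a tangent vector `vec` at `pt` has length `|vec| / (2 Im pt)`. -/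
@[ext]
structure UnitTangent where
  pt : ℍ
  vec : ℂ
  norm_vec : ‖vec‖ = 2 * pt.im

namespace UnitTangent

instance : MeasurableSpace UnitTangent :=
  MeasurableSpace.comap (fun x : UnitTangent => (x.pt, x.vec)) inferInstance

/-- The automorphy factor `c z + d`, whose inverse square is the derivative of the Möbius
transformation `g` at `z`. -/
def cocycle (g : SL(2, ℝ)) (z : ℍ) : ℂ := (g 1 0 : ℂ) * (z : ℂ) + (g 1 1 : ℂ)

lemma cocycle_ne_zero (g : SL(2, ℝ)) (z : ℍ) : cocycle g z ≠ 0 :=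
  UpperHalfPlane.denom_ne_zero (g : GL (Fin 2) ℝ) z

lemma coe_smul_eq (g : SL(2, ℝ)) (z : ℍ) :
    ((g • z : ℍ) : ℂ) = ((g 0 0 : ℂ) * (z : ℂ) + (g 0 1 : ℂ)) / cocycle g z := by
  rw [UpperHalfPlane.coe_specialLinearGroup_apply]
  rfl

lemma im_smul_eq (g : SL(2, ℝ)) (z : ℍ) : (g • z).im = z.im / ‖cocycle g z‖ ^ 2 := by
  have h : (g • z).im = _ := UpperHalfPlane.im_smul_eq_div_normSq (g : GL (Fin 2) ℝ) z
  rw [h, Complex.normSq_eq_norm_sq]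
  simp [cocycle, UpperHalfPlane.denom]

lemma cocycle_mul (g h : SL(2, ℝ)) (z : ℍ) :
    cocycle (g * h) z = cocycle g (h • z) * cocycle h z := by
  have hne := cocycle_ne_zero h z
  have e : cocycle g (h • z) * cocycle h z =
      (g 1 0 : ℂ) * ((h 0 0 : ℂ) * (z : ℂ) + (h 0 1 : ℂ)) + (g 1 1 : ℂ) * cocycle h z := by
    rw [cocycle, coe_smul_eq]
    field_simp
  rw [e]
  simp only [cocycle, Matrix.SpecialLinearGroup.coe_mul, Matrix.mul_apply, Fin.sum_univ_two]
  push_cast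
  ring

/-- `SL(2, ℝ)` acts on unit tangent vectors by the differentials of Möbius transformations. -/
instance : MulAction SL(2, ℝ) UnitTangent where
  smul g x :=
    { pt := g • x.pt
      vec := x.vec / cocycle g x.pt ^ 2
      norm_vec := by rw [norm_div, norm_pow, x.norm_vec, im_smul_eq]; ring }
  one_smul x := by
    apply UnitTangent.ext
    · exact one_smul _ x.pt
    · change x.vec / cocycle 1 x.pt ^ 2 = x.vec
      simp [cocycle]
  mul_smul g h x := by
    apply UnitTangent.ext
    · exact mul_smul g h x.pt
    · change x.vec / cocycle (g * h) x.pt ^ 2 =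
        x.vec / cocycle h x.pt ^ 2 / cocycle g (h • x.pt) ^ 2
      rw [cocycle_mul, mul_pow, div_div, mul_comm]

lemma smul_pt (g : SL(2, ℝ)) (x : UnitTangent) : (g • x).pt = g • x.pt := rfl

lemma smul_vec (g : SL(2, ℝ)) (x : UnitTangent) :
    (g • x).vec = x.vec / cocycle g x.pt ^ 2 := rfl

/-- The image at time `t` of the geodesic issued from `x`, in the disc model
`ζ ↦ (ζ - z) / (ζ - conj z)` centred at `z = x.pt`, where unit speed geodesics through the
centre are `t ↦ tanh t` times a constant of modulus one. -/
def discPt (x : UnitTangent) (t : ℝ) : ℂ :=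
  -Complex.I * (x.vec / (2 * (x.pt.im : ℂ))) * (Real.tanh t : ℂ)

lemma norm_discPt (x : UnitTangent) (t : ℝ) : ‖discPt x t‖ = |Real.tanh t| := by
  have h := x.pt.im_pos
  simp only [discPt, norm_mul, norm_neg, Complex.norm_I, norm_div, x.norm_vec,
    Complex.norm_real, Real.norm_eq_abs, abs_of_pos h, Complex.norm_ofNat]
  field_simp

lemma norm_discPt_lt_one (x : UnitTangent) (t : ℝ) : ‖discPt x t‖ < 1 := by
  rw [norm_discPt, abs_lt]
  exact ⟨Real.neg_one_lt_tanh t, Real.tanh_lt_one t⟩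

lemma one_sub_discPt_ne_zero (x : UnitTangent) (t : ℝ) : 1 - discPt x t ≠ 0 := by
  intro h
  have h1 := norm_discPt_lt_one x t
  rw [← sub_eq_zero.mp h] at h1
  simp at h1

lemma flow_im (z : ℍ) (w : ℂ) (hw : 1 - w ≠ 0) :
    (((z : ℂ) - w * (starRingEnd ℂ) (z : ℂ)) / (1 - w)).im =
      z.im * (1 - ‖w‖ ^ 2) / ‖1 - w‖ ^ 2 := by
  have hn : Complex.normSq (1 - w) ≠ 0 := by simpa using hw
  rw [← Complex.normSq_eq_norm_sq, ← Complex.normSq_eq_norm_sq, Complex.div_im]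
  field_simp
  simp [Complex.normSq_apply]
  ring

/-- The unit speed geodesic flow on the unit tangent bundle of `ℍ` (curvature `-4`). The second
component is the derivative in `t` of the first. -/
def flow (t : ℝ) (x : UnitTangent) : UnitTangent where
  pt := ⟨((x.pt : ℂ) - discPt x t * (starRingEnd ℂ) (x.pt : ℂ)) / (1 - discPt x t), by
    rw [flow_im _ _ (one_sub_discPt_ne_zero x t)]
    have h1 := norm_discPt_lt_one x t
    have h0 := norm_nonneg (discPt x t)
    have h2 : 0 < ‖1 - discPt x t‖ := norm_pos_iff.mpr (one_sub_discPt_ne_zero x t)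
    have h3 : 0 < 1 - ‖discPt x t‖ ^ 2 := by nlinarith
    have h4 := x.pt.im_pos
    positivity⟩
  vec := x.vec * (1 - (Real.tanh t : ℂ) ^ 2) / (1 - discPt x t) ^ 2
  norm_vec := by
    have h1 := norm_discPt_lt_one x t
    have h0 := norm_nonneg (discPt x t)
    have e : ‖(1 - (Real.tanh t : ℂ) ^ 2)‖ = 1 - ‖discPt x t‖ ^ 2 := by
      rw [norm_discPt, sq_abs, ← Complex.ofReal_one, ← Complex.ofReal_pow, ← Complex.ofReal_sub,
        Complex.norm_real, Real.norm_eq_abs, abs_of_nonneg]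
      rw [← sq_abs, ← norm_discPt x t]
      nlinarith
    rw [norm_div, norm_mul, norm_pow, x.norm_vec, e]
    change _ = 2 * (((x.pt : ℂ) - discPt x t * (starRingEnd ℂ) (x.pt : ℂ)) /
      (1 - discPt x t)).im
    rw [flow_im _ _ (one_sub_discPt_ne_zero x t)]
    ring

lemma discPt_smul (g : SL(2, ℝ)) (x : UnitTangent) (t : ℝ) :
    discPt (g • x) t =
      discPt x t * (starRingEnd ℂ) (cocycle g x.pt) / cocycle g x.pt := by
  have hne := cocycle_ne_zero g x.pt
  have hy : (x.pt.im : ℂ) ≠ 0 := by exact_mod_cast x.pt.im_pos.ne'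
  have hc : (starRingEnd ℂ) (cocycle g x.pt) ≠ 0 := by simpa using hne
  have e : (((g • x).pt.im : ℝ) : ℂ) =
      (x.pt.im : ℂ) / (cocycle g x.pt * (starRingEnd ℂ) (cocycle g x.pt)) := by
    rw [smul_pt, im_smul_eq, Complex.mul_conj, Complex.normSq_eq_norm_sq]
    push_cast
    rfl
  rw [discPt, discPt, e, smul_vec]
  field_simp

lemma flow_smul (t : ℝ) (g : SL(2, ℝ)) (x : UnitTangent) : flow t (g • x) = g • flow t x := by
  have hj := cocycle_ne_zero g x.pt
  have hw := one_sub_discPt_ne_zero x t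
  have hw' := one_sub_discPt_ne_zero (g • x) t
  have hJ := cocycle_ne_zero g (flow t x).pt
  have hconj : (starRingEnd ℂ) (cocycle g x.pt) =
      (g 1 0 : ℂ) * (starRingEnd ℂ) (x.pt : ℂ) + (g 1 1 : ℂ) := by simp [cocycle]
  have e1 : (1 - discPt (g • x) t) * cocycle g x.pt =
      cocycle g (flow t x).pt * (1 - discPt x t) := by
    have : cocycle g (flow t x).pt * (1 - discPt x t) =
        (g 1 0 : ℂ) * ((x.pt : ℂ) - discPt x t * (starRingEnd ℂ) (x.pt : ℂ)) +
          (g 1 1 : ℂ) * (1 - discPt x t) := by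
      change ((g 1 0 : ℂ) * (((x.pt : ℂ) - discPt x t * (starRingEnd ℂ) (x.pt : ℂ)) /
        (1 - discPt x t)) + (g 1 1 : ℂ)) * (1 - discPt x t) = _
      field_simp
    rw [this, discPt_smul, sub_mul, div_mul_cancel₀ _ hj, hconj, cocycle]
    ring
  have hd : 1 - discPt (g • x) t =
      cocycle g (flow t x).pt * (1 - discPt x t) / cocycle g x.pt := by
    rw [eq_div_iff hj, e1]
  apply UnitTangent.ext
  · apply UpperHalfPlane.ext
    rw [smul_pt, coe_smul_eq]
    change (((g • x).pt : ℂ) - discPt (g • x) t * (starRingEnd ℂ) ((g • x).pt : ℂ)) /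
        (1 - discPt (g • x) t) = ((g 0 0 : ℂ) *
          (((x.pt : ℂ) - discPt x t * (starRingEnd ℂ) (x.pt : ℂ)) / (1 - discPt x t)) +
            (g 0 1 : ℂ)) / cocycle g (flow t x).pt
    have hc : (starRingEnd ℂ) (cocycle g x.pt) ≠ 0 := by simpa using hj
    have e2 : (starRingEnd ℂ) ((g • x).pt : ℂ) =
        ((g 0 0 : ℂ) * (starRingEnd ℂ) (x.pt : ℂ) + (g 0 1 : ℂ)) /
          (starRingEnd ℂ) (cocycle g x.pt) := by
      rw [smul_pt, coe_smul_eq]; simp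
    rw [hd, e2, smul_pt, coe_smul_eq, discPt_smul]
    field_simp
    ring
  · change x.vec / cocycle g x.pt ^ 2 * (1 - (Real.tanh t : ℂ) ^ 2) /
        (1 - discPt (g • x) t) ^ 2 =
      x.vec * (1 - (Real.tanh t : ℂ) ^ 2) / (1 - discPt x t) ^ 2 /
        cocycle g (flow t x).pt ^ 2
    rw [hd]
    field_simp

/-- The unit tangent vector at `z` with Euclidean angle `θ`. -/
def ofAngle (p : ℍ × ℝ) : UnitTangent where
  pt := p.1
  vec := 2 * (p.1.im : ℂ) * Complex.exp (p.2 * Complex.I)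
  norm_vec := by
    rw [norm_mul, Complex.norm_exp_ofReal_mul_I, norm_mul, Complex.norm_real,
      Real.norm_eq_abs, abs_of_pos p.1.im_pos]
    simp

lemma measurable_ofAngle : Measurable ofAngle := by
  rw [measurable_comap_iff]
  refine Measurable.prodMk measurable_fst ?_
  have : Continuous fun p : ℍ × ℝ => 2 * (p.1.im : ℂ) * Complex.exp (p.2 * Complex.I) := by
    have := UpperHalfPlane.continuous_im
    fun_prop
  exact this.measurable

end UnitTangent

/-- The area of the metric `|dz|² / (4 (Im z)²)`, that is `dx dy / (4 y²)`
(Mathlib's `volume` on `ℍ` is `dx dy / y²`). -/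
def hypArea : Measure ℍ := (1 / 4 : ℝ≥0∞) • volume

/-- The Liouville measure `dx dy dθ / (4 y²)` on the unit tangent bundle of `ℍ`. -/
def liouville : Measure UnitTangent :=
  (hypArea.prod (volume.restrict (Set.Ioc (-Real.pi) Real.pi))).map UnitTangent.ofAngle

/-! ### The curve `C = Γ \ ℍ`, its unit tangent bundle and its cusps -/

/-- The closed Dirichlet domain of `Γ` centred at `p`. -/
def dirichletDomain (Γ : Subgroup SL(2, ℝ)) (p : ℍ) : Set ℍ :=
  {z | ∀ γ ∈ Γ, dist z p ≤ dist z (γ • p)}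

/-- `F` is a Dirichlet fundamental domain with a choice of boundary: it lies between the closed
Dirichlet domain and its interior, and meets each orbit exactly once. -/
structure IsDirichletFundamentalSet (Γ : Subgroup SL(2, ℝ)) (p : ℍ) (F : Set ℍ) : Prop where
  measurableSet : MeasurableSet F
  interior_subset : interior (dirichletDomain Γ p) ⊆ F
  subset_dirichletDomain : F ⊆ dirichletDomain Γ p
  existsUnique : ∀ z : ℍ, ∃! w : ℍ, w ∈ F ∧ ∃ γ ∈ Γ, γ • z = w

/-- The unit tangent bundle `T¹C = Γ \ T¹ℍ` of `C = Γ \ ℍ`. -/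
def QuotientTangent (Γ : Subgroup SL(2, ℝ)) : Type :=
  Quotient (MulAction.orbitRel Γ UnitTangent)

/-- The projection `T¹ℍ → T¹C`. -/
def QuotientTangent.mk (Γ : Subgroup SL(2, ℝ)) (x : UnitTangent) : QuotientTangent Γ :=
  Quotient.mk (MulAction.orbitRel Γ UnitTangent) x

instance (Γ : Subgroup SL(2, ℝ)) : MeasurableSpace (QuotientTangent Γ) :=
  inferInstanceAs (MeasurableSpace (Quotient (MulAction.orbitRel Γ UnitTangent)))

lemma QuotientTangent.measurable_mk (Γ : Subgroup SL(2, ℝ)) :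
    Measurable (QuotientTangent.mk Γ) :=
  fun _ h => h

/-- The geodesic flow `g_t` on `T¹C`. -/
def quotientFlow (Γ : Subgroup SL(2, ℝ)) (t : ℝ) : QuotientTangent Γ → QuotientTangent Γ :=
  Quotient.map (UnitTangent.flow t) (by
    rintro a b ⟨γ, rfl⟩
    exact ⟨γ, (UnitTangent.flow_smul t (γ : SL(2, ℝ)) b).symm⟩)

/-- The unit tangent vectors based in the Dirichlet domain centred at `p`. -/
def tangentDomain (Γ : Subgroup SL(2, ℝ)) (p : ℍ) : Set UnitTangent :=
  {x | x.pt ∈ dirichletDomain Γ p}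

/-- The invariant probability measure on `T¹C`, for `C` of finite area: the normalised Liouville
measure, computed on a Dirichlet domain (whose boundary is a null set). -/
def flowMeasure (Γ : Subgroup SL(2, ℝ)) (p : ℍ) : Measure (QuotientTangent Γ) :=
  (liouville (tangentDomain Γ p))⁻¹ •
    (liouville.restrict (tangentDomain Γ p)).map (QuotientTangent.mk Γ)

/-- `γ ∈ Γ` represents a simple loop around the cusp `c` of `Γ \ ℍ`: it is parabolic with fixed
point `c` and generates the stabiliser of `c` in `Γ`, up to sign. -/
structure IsSimpleCuspLoop (Γ : Subgroup SL(2, ℝ)) (c : OnePoint ℝ) (γ : Γ) : Prop where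
  isParabolic : ((γ : SL(2, ℝ)) : GL (Fin 2) ℝ).IsParabolic
  smul_eq : ((γ : SL(2, ℝ)) : GL (Fin 2) ℝ) • c = c
  generates : ∀ δ : Γ, ((δ : SL(2, ℝ)) : GL (Fin 2) ℝ) • c = c →
    ∃ n : ℤ, (δ : SL(2, ℝ)) = (γ : SL(2, ℝ)) ^ n ∨ (δ : SL(2, ℝ)) = -(γ : SL(2, ℝ)) ^ n

/-! ### Flat bundles, constant norms and integrability -/

section FlatBundle

variable {V : Type*} [NormedAddCommGroup V] [NormedSpace ℂ V]
variable (Γ : Subgroup SL(2, ℝ)) (ρ : Representation ℂ Γ V)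

/-- The orbit relation of the diagonal action of `Γ` on `T¹ℍ × V`. -/
def flatSetoid : Setoid (UnitTangent × V) where
  r a b := ∃ γ : Γ, γ • a.1 = b.1 ∧ ρ γ a.2 = b.2
  iseqv :=
    { refl := fun a => ⟨1, by simp⟩
      symm := by
        rintro a b ⟨γ, h1, h2⟩
        refine ⟨γ⁻¹, by rw [← h1, inv_smul_smul], ?_⟩
        rw [← h2, ← Module.End.mul_apply, ← map_mul]
        simp
      trans := by
        rintro a b c ⟨γ, h1, h2⟩ ⟨δ, h3, h4⟩
        refine ⟨δ * γ, by rw [mul_smul, h1, h3], ?_⟩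
        rw [map_mul, Module.End.mul_apply, h2, h4] }

/-- The total space `Γ \ (T¹ℍ × V)` of the flat bundle with monodromy `ρ`, pulled back from `C`
to `T¹C`. -/
def FlatBundle : Type _ := Quotient (flatSetoid Γ ρ)

/-- The point of the flat bundle represented by `(x, v)`. -/
def FlatBundle.mk (x : UnitTangent) (v : V) : FlatBundle Γ ρ :=
  Quotient.mk (flatSetoid Γ ρ) (x, v)

/-- The bundle projection to `T¹C`. -/
def FlatBundle.proj : FlatBundle Γ ρ → QuotientTangent Γ :=
  Quotient.lift (fun a => QuotientTangent.mk Γ a.1) (by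
    rintro a b ⟨γ, h1, _⟩
    refine (Quotient.sound (s := MulAction.orbitRel Γ UnitTangent) ?_).symm
    exact ⟨γ, h1⟩)

/-- The lift `G_t` of the geodesic flow to the flat bundle by parallel transport. -/
def FlatBundle.transport (t : ℝ) : FlatBundle Γ ρ → FlatBundle Γ ρ :=
  Quotient.map (fun a => (UnitTangent.flow t a.1, a.2)) (by
    rintro a b ⟨γ, h1, h2⟩
    refine ⟨γ, ?_, h2⟩
    change γ • UnitTangent.flow t a.1 = UnitTangent.flow t b.1
    rw [← h1]
    exact (UnitTangent.flow_smul t (γ : SL(2, ℝ)) a.1).symm)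

/-- `G_t` covers the geodesic flow. -/
lemma FlatBundle.proj_transport (t : ℝ) (e : FlatBundle Γ ρ) :
    FlatBundle.proj Γ ρ (FlatBundle.transport Γ ρ t e) =
      quotientFlow Γ t (FlatBundle.proj Γ ρ e) := by
  induction e using Quotient.inductionOn
  rfl

/-- The constant norm: the norm of `V`, extended by parallel transport over `F`. The infimum is
over a single number by `constNorm_mk`. -/
def constNorm (F : Set ℍ) (e : FlatBundle Γ ρ) : ℝ :=
  sInf {r | ∃ x : UnitTangent, ∃ v : V, x.pt ∈ F ∧ FlatBundle.mk Γ ρ x v = e ∧ r = ‖v‖}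

lemma constNorm_mk {p : ℍ} {F : Set ℍ} (hF : IsDirichletFundamentalSet Γ p F)
    (hfree : ∀ γ ∈ Γ, ∀ z : ℍ, γ • z = z → γ = 1 ∨ γ = -1)
    (hρ : ∀ γ : Γ, (γ : SL(2, ℝ)) = -1 → ρ γ = 1)
    (x : UnitTangent) (hx : x.pt ∈ F) (v : V) :
    constNorm Γ ρ F (FlatBundle.mk Γ ρ x v) = ‖v‖ := by
  have : {r | ∃ x' : UnitTangent, ∃ v' : V, x'.pt ∈ F ∧
      FlatBundle.mk Γ ρ x' v' = FlatBundle.mk Γ ρ x v ∧ r = ‖v'‖} = {‖v‖} := by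
    ext r
    simp only [Set.mem_ofPred_eq, Set.mem_singleton_iff]
    constructor
    · rintro ⟨x', v', hx', he, rfl⟩
      obtain ⟨γ, h1, h2⟩ := Quotient.exact he
      have h1' : (γ : SL(2, ℝ)) • x'.pt = x.pt := congrArg UnitTangent.pt h1
      have h3 : x.pt = x'.pt := (hF.existsUnique x'.pt).unique
        ⟨hx, γ, γ.2, h1'⟩ ⟨hx', 1, Γ.one_mem, one_smul _ _⟩
      have h4 : ρ γ = 1 := by
        rcases hfree γ γ.2 x'.pt (h1'.trans h3) with h | h
        · have : γ = 1 := Subtype.ext h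
          rw [this, map_one]
        · exact hρ γ h
      have h5 : ρ γ v' = v := h2
      rw [h4] at h5
      exact congrArg norm h5
    · rintro rfl
      exact ⟨x, v, hx, rfl, rfl⟩
  rw [constNorm, this, csInf_singleton]

/-- The operator norm `‖A(x,t)‖` of the parallel transport along the geodesic from `x` to
`g_t x`, for the norm `nrm` on the bundle. -/
def transportNorm (nrm : FlatBundle Γ ρ → ℝ) (x : QuotientTangent Γ) (t : ℝ) : ℝ :=
  sSup {r | ∃ e : FlatBundle Γ ρ, FlatBundle.proj Γ ρ e = x ∧ nrm e ≠ 0 ∧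
    r = nrm (FlatBundle.transport Γ ρ t e) / nrm e}

/-- The flat bundle with norm `nrm` is integrable over the geodesic flow with respect to `μ`:
`∫ sup_{t ∈ [-1,1]} log⁺ ‖A(x,t)‖ dμ(x) < ∞`. -/
def IsIntegrableFlatBundle (nrm : FlatBundle Γ ρ → ℝ) (μ : Measure (QuotientTangent Γ)) : Prop :=
  ∫⁻ x, (⨆ t ∈ Set.Icc (-1 : ℝ) 1,
    ENNReal.ofReal (Real.posLog (transportNorm Γ ρ nrm x t))) ∂μ < ∞

end FlatBundle

end GeodesicCocycle

end

open GeodesicCocycle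

namespace GeodesicCocycle

open Filter Topology

/-! Move the cusp to infinity by some `k`, so that the loop acts as a translation by `h ≠ 0`. After
conjugating the loop within `Γ`, the centre `p` has the highest image in its orbit, and a vertical
half-strip around it lies in the Dirichlet domain (`exists_strip_subset_dirichletDomain`).

A unit vector at height `y` in this strip, within `π / 3` of the horizontal, flows a Euclidean
distance of order `y` to either side during `[-1, 1]`, while its height stays comparable to `y`. At
a suitable time it is therefore an exact translate, by about `y / |h|` powers of the loop, of a
point of the strip. Parallel transport in the constant frame is then that power of the monodromy. An
eigenvalue of modulus different from one, with the right sign of the exponent, makes the logarithm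
of its norm at least `C * y` (`exists_mul_im_le_iSup_posLog`).

The area density is `1 / y ^ 2` up to a constant, so the integral dominates `∫ dy / y` over a
half-line, which diverges (`setLIntegral_cuspStrip_im`). `lintegral_flowMeasure_eq_top` carries this
divergence down to the quotient. -/

/-! ### Normalising the cusp, and finiteness from discreteness -/

/-- `SL(2, ℝ)` is transitive on the boundary, so some `g` sends infinity to `c`. The conjugate of
`γ` by `g` is upper triangular, and being parabolic forces equal diagonal entries and a nonzero
corner: it is a translation. -/
lemma exists_conj_eq_vadd {c : OnePoint ℝ} {γ : SL(2, ℝ)}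
    (hpar : (γ : GL (Fin 2) ℝ).IsParabolic) (hc : (γ : GL (Fin 2) ℝ) • c = c) :
    ∃ (k : SL(2, ℝ)) (h : ℝ), h ≠ 0 ∧ ∀ z : ℍ, k • γ • z = h +ᵥ k • z := by
  obtain ⟨g, hg⟩ := OnePoint.exists_mem_SL2 ℝ c
  have hg' : (g : GL (Fin 2) ℝ) • (OnePoint.infty : OnePoint ℝ) = c := hg
  set m : SL(2, ℝ) := g⁻¹ * γ * g with hm
  have hmc : (m : GL (Fin 2) ℝ) = (g : GL (Fin 2) ℝ)⁻¹ * γ * g := by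
    rw [hm]; simp
  have hpar' : (m : GL (Fin 2) ℝ).IsParabolic := by
    rw [hmc]
    simpa using hpar
  have hfix : (m : GL (Fin 2) ℝ) • (OnePoint.infty : OnePoint ℝ) = OnePoint.infty := by
    rw [hmc, mul_smul, mul_smul, hg', hc, inv_smul_eq_iff, hg']
  have h10 : (m : GL (Fin 2) ℝ) 1 0 = 0 := OnePoint.smul_infty_eq_self_iff.mp hfix
  obtain ⟨h0, h1⟩ :=
    (Matrix.GeneralLinearGroup.isParabolic_iff_of_upperTriangular h10).mp hpar'
  have h10' : m 1 0 = 0 := h10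
  have h0' : m 0 0 = m 1 1 := h0
  have h1' : m 0 1 ≠ 0 := h1
  have hdet : m 0 0 * m 1 1 - m 0 1 * m 1 0 = 1 := by
    rw [← Matrix.det_fin_two, m.det_coe]
  have h11 : m 1 1 ≠ 0 := by
    rintro h
    simp [h, h10'] at hdet
  refine ⟨g⁻¹, m 0 1 / m 1 1, div_ne_zero h1' h11, fun z => ?_⟩
  have hz : g⁻¹ • γ • z = m • (g⁻¹ • z) := by
    simp [hm, mul_smul]
  rw [hz]
  apply UpperHalfPlane.ext
  rw [UnitTangent.coe_smul_eq, UnitTangent.cocycle, h10', h0', UpperHalfPlane.coe_vadd]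
  have : (m 1 1 : ℂ) ≠ 0 := by exact_mod_cast h11
  push_cast
  rw [zero_mul, zero_add, add_div, mul_div_cancel_left₀ _ this, add_comm]

/-- Proper discontinuity of the action, applied to `{p}` and the compact set `k⁻¹ • K`. -/
lemma finite_smul_mem_of_isCompact (Γ : Subgroup SL(2, ℝ)) [DiscreteTopology Γ]
    (k : SL(2, ℝ)) (p : ℍ) {K : Set ℍ} (hK : IsCompact K) :
    {δ : Γ | k • δ • p ∈ K}.Finite := by
  have h2 : IsCompact ((fun z : ℍ => k⁻¹ • z) '' K) := hK.image (continuous_const_smul _)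
  refine (ProperlyDiscontinuousSMul.finite_disjoint_inter_image (Γ := Γ)
    (isCompact_singleton (x := p)) h2).subset ?_
  intro δ hδ
  refine ⟨δ • p, ⟨p, rfl, rfl⟩, k • δ • p, hδ, ?_⟩
  simp

lemma isCompact_rectangle (a b : ℝ) {u : ℝ} (hu : 0 < u) (v : ℝ) :
    IsCompact {z : ℍ | z.re ∈ Set.Icc a b ∧ z.im ∈ Set.Icc u v} := by
  rw [UpperHalfPlane.isOpenEmbedding_coe.isEmbedding.isCompact_iff]
  have : (UpperHalfPlane.coe '' {z : ℍ | z.re ∈ Set.Icc a b ∧ z.im ∈ Set.Icc u v}) =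
      Set.Icc a b ×ℂ Set.Icc u v := by
    ext w
    constructor
    · rintro ⟨z, ⟨h1, h2⟩, rfl⟩
      exact ⟨h1, h2⟩
    · rintro ⟨h1, h2⟩
      exact ⟨⟨w, hu.trans_le h2.1⟩, ⟨h1, h2⟩, rfl⟩
  rw [this]
  exact isCompact_Icc.reProdIm isCompact_Icc

/-! ### Orbit heights at the cusp and a half-strip in the Dirichlet domain -/

section Cusp

variable {Γ : Subgroup SL(2, ℝ)} {γ : Γ} {k : SL(2, ℝ)} {h : ℝ}

lemma smul_zpow_smul (hk : ∀ z : ℍ, k • (γ : SL(2, ℝ)) • z = h +ᵥ k • z) (n : ℤ) (z : ℍ) :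
    k • (γ ^ n) • z = ((n * h : ℝ) +ᵥ k • z : ℍ) := by
  induction n using Int.induction_on generalizing z with
  | zero => simp
  | succ n ih =>
    rw [zpow_add_one, mul_smul, ih]
    change _ +ᵥ k • (γ : SL(2, ℝ)) • z = _
    rw [hk, vadd_vadd]
    congr 1
    push_cast
    ring
  | pred n ih =>
    have h1 := hk ((γ⁻¹ : Γ) • z)
    have h2 : (γ : SL(2, ℝ)) • (γ⁻¹ : Γ) • z = z := smul_inv_smul γ z
    rw [h2] at h1
    rw [zpow_sub_one, mul_smul, ih, h1, vadd_vadd]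
    congr 1
    push_cast
    ring

lemma exists_zpow_re_mem (hk : ∀ z : ℍ, k • (γ : SL(2, ℝ)) • z = h +ᵥ k • z) (hh : h ≠ 0)
    (z : ℍ) : ∃ n : ℤ, (k • (γ ^ n) • z).re ∈ Set.Icc 0 |h| ∧
      (k • (γ ^ n) • z).im = (k • z).im := by
  have key : ∃ n : ℤ, (n : ℝ) * h + (k • z).re ∈ Set.Icc 0 |h| := by
    obtain ⟨n, hn, -⟩ := existsUnique_add_zsmul_mem_Ico (abs_pos.mpr hh) (k • z).re 0
    rw [zero_add, zsmul_eq_mul] at hn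
    rcases abs_choice h with e | e <;> rw [e] at hn ⊢
    · exact ⟨n, by linarith [hn.1], by linarith [hn.2]⟩
    · refine ⟨-n, ?_, ?_⟩ <;> push_cast <;> linarith [hn.1, hn.2]
  obtain ⟨n, hn⟩ := key
  refine ⟨n, ?_, ?_⟩ <;> rw [smul_zpow_smul hk]
  · simpa using hn
  · simp

/-- A translation by `h` moves a point at height `y` by at most `|h| / y`. If `k • δ • p` were too
high, `δ⁻¹ * γ * δ` would move `p` by less than the gap between `p` and the rest of its orbit, hence
fix `p`; but a nontrivial translation has no fixed point. -/
lemma exists_im_orbit_le [DiscreteTopology Γ]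
    (hk : ∀ z : ℍ, k • (γ : SL(2, ℝ)) • z = h +ᵥ k • z) (hh : h ≠ 0) (p : ℍ) :
    ∃ B : ℝ, ∀ δ : Γ, (k • δ • p).im ≤ B := by
  have hfin := finite_smul_mem_of_isCompact Γ 1 p (isCompact_closedBall p 1)
  -- The gap `r` is taken below `1`, so that only the finitely many `δ` bringing `p` into the unit
  -- ball matter.
  obtain ⟨r, hr0, hr⟩ : ∃ r > 0, ∀ δ : Γ, dist (δ • p) p < r → δ • p = p := by
    have hev : ∀ᶠ r : ℝ in 𝓝[>] 0, ∀ δ ∈ {δ : Γ | (1 : SL(2, ℝ)) • δ • p ∈ Metric.closedBall p 1},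
        dist (δ • p) p < r → δ • p = p := by
      rw [eventually_all_finite hfin]
      intro δ _
      by_cases e : δ • p = p
      · simp [e]
      · filter_upwards [eventually_nhdsWithin_of_eventually_nhds
          (eventually_lt_nhds (dist_pos.mpr e))] with r hr h
        exact absurd h hr.not_gt
    obtain ⟨r, hr, hr0, hr1⟩ := (hev.and (Ioo_mem_nhdsGT one_pos)).exists
    refine ⟨r, hr0, fun δ hδ => hr δ ?_ hδ⟩
    simpa using (hδ.trans hr1).le
  refine ⟨|h| / r, fun δ => le_of_not_gt fun hlt => ?_⟩
  set w := k • δ • p with hw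
  have hd : dist ((δ⁻¹ * γ * δ) • p) p < r := by
    have e1 : dist ((δ⁻¹ * γ * δ) • p) p = dist (k • (γ : SL(2, ℝ)) • δ • p) w := by
      rw [hw, dist_smul, mul_smul, mul_smul]
      conv_rhs => rw [← dist_smul ((δ : SL(2, ℝ))⁻¹)]
      congr 1
      exact (inv_smul_smul δ p).symm
    rw [e1, hk, ← hw]
    refine (UpperHalfPlane.dist_le_dist_coe_div_sqrt _ _).trans_lt ?_
    have e2 : dist ((h +ᵥ w : ℍ) : ℂ) w = |h| := by
      rw [UpperHalfPlane.coe_vadd, Complex.dist_eq]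
      simp
    rw [e2, UpperHalfPlane.vadd_im, Real.sqrt_mul_self w.im_pos.le, div_lt_comm₀ w.im_pos hr0]
    exact hlt
  have hfix := hr _ hd
  have hfix' : (γ : SL(2, ℝ)) • δ • p = δ • p := by
    rw [mul_smul, mul_smul, inv_smul_eq_iff] at hfix
    exact hfix
  have h1 := hk (δ • p)
  rw [hfix'] at h1
  have h2 := congrArg UpperHalfPlane.re h1
  rw [UpperHalfPlane.vadd_re] at h2
  exact hh (by linarith)

/-- Powers of `γ` bring any orbit point over `[0, |h|]` without changing its height. Orbit points at
least as high as `k • p` thus reduce to a compact rectangle, which contains finitely many of them.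
-/
lemma exists_forall_im_orbit_le [DiscreteTopology Γ]
    (hk : ∀ z : ℍ, k • (γ : SL(2, ℝ)) • z = h +ᵥ k • z) (hh : h ≠ 0) (p : ℍ) :
    ∃ δ₀ : Γ, ∀ δ : Γ, (k • δ • p).im ≤ (k • δ₀ • p).im := by
  obtain ⟨B, hB⟩ := exists_im_orbit_le hk hh p
  have hfin := finite_smul_mem_of_isCompact Γ k p
    (isCompact_rectangle 0 |h| (k • p).im_pos B)
  obtain ⟨n₀, hn₀, hn₀'⟩ := exists_zpow_re_mem hk hh p
  have hne : {δ : Γ | k • δ • p ∈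
      {z : ℍ | z.re ∈ Set.Icc 0 |h| ∧ z.im ∈ Set.Icc (k • p).im B}}.Nonempty :=
    ⟨γ ^ n₀, hn₀, hn₀'.ge, hB _⟩
  obtain ⟨δ₀, hδ₀, hmax⟩ := hfin.exists_maximalFor (fun δ => (k • δ • p).im) _ hne
  refine ⟨δ₀, fun δ => ?_⟩
  rcases le_total (k • δ • p).im (k • p).im with hle | hle
  · exact hle.trans hδ₀.2.1
  · obtain ⟨n, hn, hn'⟩ := exists_zpow_re_mem hk hh (δ • p)
    rw [← hn']
    rw [← mul_smul] at hn hn' ⊢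
    rcases le_total (k • (γ ^ n * δ) • p).im (k • δ₀ • p).im with h1 | h1
    · exact h1
    · exact hmax (j := γ ^ n * δ) ⟨hn, hn' ▸ hle, hB _⟩ h1

lemma dist_le_dist_iff (z w w' : ℍ) : dist z w ≤ dist z w' ↔
    ((z.re - w.re) ^ 2 + z.im ^ 2 + w.im ^ 2) * w'.im ≤
      ((z.re - w'.re) ^ 2 + z.im ^ 2 + w'.im ^ 2) * w.im := by
  have hz := z.im_pos
  have hw := w.im_pos
  have hw' := w'.im_pos
  rw [← abs_of_nonneg (dist_nonneg (x := z) (y := w)),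
    ← abs_of_nonneg (dist_nonneg (x := z) (y := w')), ← Real.cosh_le_cosh,
    UpperHalfPlane.cosh_dist', UpperHalfPlane.cosh_dist', div_le_div_iff₀ (by positivity)
    (by positivity)]
  constructor <;> intro h1
  · refine le_of_mul_le_mul_left ?_ (by positivity : 0 < 2 * z.im)
    linarith
  · have := mul_le_mul_of_nonneg_left h1 (by positivity : 0 ≤ 2 * z.im)
    linarith

/-- In `dist_le_dist_iff` the right side minus the left is a nonnegative multiple of `w.im` plus
`(w.im - w'.im) * ((z.re - w.re) ^ 2 + z.im ^ 2 - w.im * w'.im)`. -/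
lemma dist_le_dist_of_abs_re_sub_le {z w w' : ℍ} (him : w'.im ≤ w.im) (hz : w.im ≤ z.im)
    (hre : |z.re - w.re| ≤ |z.re - w'.re|) : dist z w ≤ dist z w' := by
  rw [dist_le_dist_iff]
  have h1 := sq_le_sq.mpr hre
  have := w'.im_pos
  have := w.im_pos
  have h2 : w'.im * w.im ≤ z.im ^ 2 := by nlinarith
  nlinarith [mul_nonneg (sub_nonneg.mpr him) (sub_nonneg.mpr h2),
    mul_le_mul_of_nonneg_right h1 w.im_pos.le,
    mul_nonneg (sub_nonneg.mpr him) (sq_nonneg (z.re - w.re))]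

lemma dist_le_dist_of_sq_le {z w w' : ℍ} (hre : |z.re - w.re| ≤ 1)
    (hz : (1 + w.im ^ 2) * w'.im ≤ z.im ^ 2 * (w.im - w'.im)) : dist z w ≤ dist z w' := by
  rw [dist_le_dist_iff]
  have h1 : (z.re - w.re) ^ 2 ≤ 1 := by
    rw [← sq_abs]
    have := abs_nonneg (z.re - w.re)
    nlinarith
  have := w'.im_pos
  have := w.im_pos
  nlinarith [mul_nonneg (sq_nonneg (z.re - w'.re)) w.im_pos.le,
    mul_nonneg (sq_nonneg w'.im) w.im_pos.le, mul_le_mul_of_nonneg_right h1 w'.im_pos.le]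

/-- Seen from far up, the strictly higher point is nearer. At equal heights the horizontal distance
decides, and `w` wins for real parts near its own. -/
lemma eventually_dist_le_dist {w w' : ℍ} (him : w'.im ≤ w.im) :
    ∀ᶠ q : ℝ × ℝ in 𝓝 w.re ×ˢ atTop, ∀ z : ℍ, z.re = q.1 → z.im = q.2 →
      dist z w ≤ dist z w' := by
  rcases him.lt_or_eq with hlt | heq
  · have hx : ∀ᶠ x : ℝ in 𝓝 w.re, |x - w.re| ≤ 1 := by
      filter_upwards [Metric.closedBall_mem_nhds w.re one_pos] with x hx
      simpa [Real.dist_eq] using hx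
    have hy : ∀ᶠ y : ℝ in atTop, (1 + w.im ^ 2) * w'.im ≤ y ^ 2 * (w.im - w'.im) :=
      ((tendsto_pow_atTop two_ne_zero).atTop_mul_const
        (sub_pos.mpr hlt)).eventually_ge_atTop _
    filter_upwards [hx.prod_mk hy] with q hq z h1 h2
    rw [← h1, ← h2] at hq
    exact dist_le_dist_of_sq_le hq.1 hq.2
  · have hx : ∀ᶠ x : ℝ in 𝓝 w.re, |x - w.re| ≤ |x - w'.re| := by
      by_cases e : w.re = w'.re
      · simp [e]
      · have : ∀ᶠ x : ℝ in 𝓝 w.re, |x - w.re| < |x - w'.re| := by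
          apply ContinuousAt.eventually_lt (by fun_prop) (by fun_prop)
          simpa [sub_eq_zero] using e
        exact this.mono fun x h => h.le
    filter_upwards [hx.prod_mk (eventually_ge_atTop w.im)] with q hq z h1 h2
    rw [← h1, ← h2] at hq
    exact dist_le_dist_of_abs_re_sub_le him hq.2 hq.1

/-- The difficulty is uniformity over the infinite orbit. Points horizontally farther away than `w`,
or at most half as high, lose to `w` by explicit bounds independent of `δ`; the others lie in a
fixed rectangle, so `eventually_dist_le_dist` is needed only finitely often. -/
lemma exists_strip_subset_dirichletDomain [DiscreteTopology Γ] {p : ℍ}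
    (hmax : ∀ δ : Γ, (k • δ • p).im ≤ (k • p).im) :
    ∃ ε > 0, ∃ Y > 0, ∀ z : ℍ, |(k • z).re - (k • p).re| < ε → Y < (k • z).im →
      z ∈ dirichletDomain Γ p := by
  set w := k • p with hw
  have hfin := finite_smul_mem_of_isCompact Γ k p
    (isCompact_rectangle (w.re - 2) (w.re + 2) (half_pos w.im_pos) w.im)
  have hev : ∀ᶠ q : ℝ × ℝ in 𝓝 w.re ×ˢ atTop, ∀ δ ∈ {δ : Γ | k • δ • p ∈
      {z : ℍ | z.re ∈ Set.Icc (w.re - 2) (w.re + 2) ∧ z.im ∈ Set.Icc (w.im / 2) w.im}},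
      ∀ z : ℍ, z.re = q.1 → z.im = q.2 → dist z w ≤ dist z (k • δ • p) := by
    rw [eventually_all_finite hfin]
    exact fun δ _ => eventually_dist_le_dist (hmax δ)
  have hx : ∀ᶠ x : ℝ in 𝓝 w.re, |x - w.re| ≤ 1 := by
    filter_upwards [Metric.closedBall_mem_nhds w.re one_pos] with x hx
    simpa [Real.dist_eq] using hx
  have hy : ∀ᶠ y : ℝ in atTop, w.im ≤ y ∧ 1 + w.im ^ 2 ≤ y ^ 2 :=
    (eventually_ge_atTop _).and ((tendsto_pow_atTop two_ne_zero).eventually_ge_atTop _)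
  have hall : ∀ᶠ q : ℝ × ℝ in 𝓝 w.re ×ˢ atTop, ∀ z : ℍ, z.re = q.1 → z.im = q.2 →
      ∀ δ : Γ, dist z w ≤ dist z (k • δ • p) := by
    filter_upwards [hev, hx.prod_mk hy] with q hq hxy z h1 h2 δ
    obtain ⟨hx1, hy1, hy2⟩ := hxy
    rw [← h1] at hx1
    rw [← h2] at hy1 hy2
    have hv := (k • δ • p).im_pos
    have hv' := hmax δ
    rcases le_total |z.re - w.re| |z.re - (k • δ • p).re| with hle | hle
    · exact dist_le_dist_of_abs_re_sub_le hv' hy1 hle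
    rcases le_total (k • δ • p).im (w.im / 2) with hlow | hlow
    · refine dist_le_dist_of_sq_le hx1 ?_
      have : (k • δ • p).im ≤ w.im - (k • δ • p).im := by linarith
      exact mul_le_mul hy2 this hv.le (sq_nonneg _)
    · refine hq δ ⟨?_, hlow, hv'⟩ z h1 h2
      have h3 := abs_le.mp hx1
      have h4 := abs_le.mp (hle.trans hx1)
      constructor <;> linarith
  obtain ⟨s, hs, t, ht, hst⟩ := mem_prod_iff.mp hall
  obtain ⟨ε, hε, hεs⟩ := Metric.mem_nhds_iff.mp hs
  obtain ⟨Y, hY⟩ := mem_atTop_sets.mp ht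
  refine ⟨ε, hε, max Y 1, by positivity, fun z h1 h2 δ hδ => ?_⟩
  have := hst (Set.mk_mem_prod (hεs (by simpa [Real.dist_eq] using h1))
    (hY _ ((le_max_left _ _).trans h2.le))) (k • z) rfl rfl ⟨δ, hδ⟩
  rwa [hw, dist_smul, dist_smul] at this

end Cusp

/-! ### Euclidean displacement along a geodesic -/

lemma strictMono_tanh : StrictMono Real.tanh := fun x y hxy => by
  rw [← Real.artanh_lt_artanh_iff ⟨Real.neg_one_lt_tanh x, Real.tanh_lt_one x⟩
    ⟨Real.neg_one_lt_tanh y, Real.tanh_lt_one y⟩, Real.artanh_tanh, Real.artanh_tanh]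
  exact hxy

lemma continuous_tanh : Continuous Real.tanh := by
  have : Real.tanh = fun x => Real.sinh x / Real.cosh x := funext Real.tanh_eq_sinh_div_cosh
  rw [this]
  exact Real.continuous_sinh.div Real.continuous_cosh fun x => (Real.cosh_pos x).ne'

namespace UnitTangent

lemma flow_pt_im (t : ℝ) (x : UnitTangent) :
    (flow t x).pt.im = x.pt.im * (1 - Real.tanh t ^ 2) / ‖1 - discPt x t‖ ^ 2 := by
  rw [← sq_abs (Real.tanh t), ← norm_discPt x t]
  exact flow_im _ _ (one_sub_discPt_ne_zero x t)

lemma flow_pt_re (t : ℝ) (x : UnitTangent) :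
    (flow t x).pt.re = x.pt.re + x.vec.re * Real.tanh t / ‖1 - discPt x t‖ ^ 2 := by
  have hy := x.pt.im_pos
  have him : (discPt x t).im = -(x.vec.re / (2 * x.pt.im) * Real.tanh t) := by
    have e : (2 * (x.pt.im : ℂ)) = ((2 * x.pt.im : ℝ) : ℂ) := by push_cast; rfl
    rw [discPt, e, Complex.im_mul_ofReal, neg_mul, Complex.neg_im, Complex.I_mul_im,
      Complex.div_ofReal_re, neg_mul]
  have hn : Complex.normSq (1 - discPt x t) ≠ 0 := by simpa using one_sub_discPt_ne_zero x t
  have e2 : x.vec.re * Real.tanh t = -(2 * x.pt.im * (discPt x t).im) := by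
    rw [him]
    field_simp
  rw [e2, ← Complex.normSq_eq_norm_sq]
  change (((x.pt : ℂ) - discPt x t * (starRingEnd ℂ) (x.pt : ℂ)) / (1 - discPt x t)).re = _
  generalize discPt x t = w at *
  rw [Complex.div_re]
  field_simp
  simp [Complex.normSq_apply]
  ring

lemma norm_one_sub_discPt_sq_le (x : UnitTangent) (t : ℝ) : ‖1 - discPt x t‖ ^ 2 ≤ 4 := by
  have h1 := norm_sub_le 1 (discPt x t)
  have h2 := norm_discPt_lt_one x t
  rw [norm_one] at h1
  have h0 := norm_nonneg (1 - discPt x t)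
  nlinarith

lemma norm_one_sub_discPt_sq_pos (x : UnitTangent) (t : ℝ) : 0 < ‖1 - discPt x t‖ ^ 2 :=
  pow_pos (norm_pos_iff.mpr (one_sub_discPt_ne_zero x t)) 2

lemma continuous_flow_pt_re (x : UnitTangent) : Continuous fun t => (flow t x).pt.re := by
  have hd : Continuous fun t => discPt x t := by
    have := continuous_tanh
    unfold discPt
    fun_prop
  simp only [flow_pt_re]
  exact continuous_const.add ((continuous_const.mul continuous_tanh).div (by fun_prop)
    fun t => (norm_one_sub_discPt_sq_pos x t).ne')

lemma mul_sub_tanh_sq_le_flow_pt_im (x : UnitTangent) {t : ℝ} (ht : t ∈ Set.Icc (-1 : ℝ) 1) :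
    x.pt.im * ((1 - Real.tanh 1 ^ 2) / 4) ≤ (flow t x).pt.im := by
  have hy := x.pt.im_pos
  have h1 : Real.tanh t ^ 2 ≤ Real.tanh 1 ^ 2 := by
    refine sq_le_sq' ?_ (strictMono_tanh.monotone ht.2)
    rw [← Real.tanh_neg]
    exact strictMono_tanh.monotone ht.1
  have h2 := Real.tanh_lt_one 1
  have h3 := Real.neg_one_lt_tanh 1
  rw [flow_pt_im, le_div_iff₀ (norm_one_sub_discPt_sq_pos x t)]
  have h4 := norm_one_sub_discPt_sq_le x t
  have h5 : 0 ≤ x.pt.im * ((1 - Real.tanh 1 ^ 2) / 4) := by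
    have : 0 ≤ 1 - Real.tanh 1 ^ 2 := by nlinarith
    positivity
  calc x.pt.im * ((1 - Real.tanh 1 ^ 2) / 4) * ‖1 - discPt x t‖ ^ 2
      ≤ x.pt.im * ((1 - Real.tanh 1 ^ 2) / 4) * 4 := by gcongr
    _ = x.pt.im * (1 - Real.tanh 1 ^ 2) := by ring
    _ ≤ _ := by gcongr

lemma tanh_one_pos : 0 < Real.tanh 1 := by
  rw [← Real.tanh_zero]
  exact strictMono_tanh one_pos

/-- The real part moves by `x.vec.re * tanh t / ‖1 - discPt x t‖ ^ 2`, whose denominator is at most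
`4`. At `t = ±1` it has therefore moved by at least `x.pt.im * tanh 1 / 4` to either side, and the
intermediate value theorem gives every smaller displacement. -/
lemma exists_flow_pt_re_eq {x : UnitTangent} (hx : x.pt.im ≤ x.vec.re) {s : ℝ}
    (hs : |s| ≤ x.pt.im * (Real.tanh 1 / 4)) :
    ∃ t ∈ Set.Icc (-1 : ℝ) 1, (flow t x).pt.re = x.pt.re + s := by
  have hτ := tanh_one_pos
  have hy := x.pt.im_pos
  have key (t : ℝ) : x.pt.im * (Real.tanh 1 / 4) ≤
      x.vec.re * Real.tanh 1 / ‖1 - discPt x t‖ ^ 2 := by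
    rw [le_div_iff₀ (norm_one_sub_discPt_sq_pos x t)]
    calc x.pt.im * (Real.tanh 1 / 4) * ‖1 - discPt x t‖ ^ 2
        ≤ x.pt.im * (Real.tanh 1 / 4) * 4 := by
          gcongr
          exact norm_one_sub_discPt_sq_le x t
      _ = x.pt.im * Real.tanh 1 := by ring
      _ ≤ _ := by gcongr
  have hs' := abs_le.mp hs
  refine intermediate_value_Icc (by norm_num) (continuous_flow_pt_re x).continuousOn ⟨?_, ?_⟩
  · have := key (-1)
    rw [flow_pt_re, Real.tanh_neg, mul_neg, neg_div]
    linarith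
  · have := key 1
    rw [flow_pt_re]
    linarith

end UnitTangent

open UnitTangent

/-! ### Growth of parallel transport near the cusp -/

section Transport

variable {V : Type*} [NormedAddCommGroup V] [NormedSpace ℂ V]
variable {Γ : Subgroup SL(2, ℝ)} {ρ : Representation ℂ Γ V}

lemma FlatBundle.exists_eq_mk {x : UnitTangent} {e : FlatBundle Γ ρ}
    (he : FlatBundle.proj Γ ρ e = QuotientTangent.mk Γ x) :
    ∃ v : V, e = FlatBundle.mk Γ ρ x v := by
  induction e using Quotient.inductionOn with
  | h b =>
    obtain ⟨δ, hδ⟩ := Quotient.exact he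
    have hδ' : δ • x = b.1 := hδ
    refine ⟨ρ δ⁻¹ b.2, Quotient.sound ⟨δ⁻¹, ?_, rfl⟩⟩
    rw [← hδ', inv_smul_smul]

lemma FlatBundle.mk_smul (δ : Γ) (x : UnitTangent) (v : V) :
    FlatBundle.mk Γ ρ (δ • x) (ρ δ v) = FlatBundle.mk Γ ρ x v :=
  (Quotient.sound ⟨δ, rfl, rfl⟩ : FlatBundle.mk Γ ρ x v = _).symm

lemma FlatBundle.transport_mk (t : ℝ) (x : UnitTangent) (v : V) :
    FlatBundle.transport Γ ρ t (FlatBundle.mk Γ ρ x v) = FlatBundle.mk Γ ρ (flow t x) v := rfl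

/-- In the frames given by representatives over `F`, the transport is `ρ δ`, where `δ` brings the
endpoint of the lifted geodesic back to `F`. -/
lemma norm_div_norm_le_transportNorm [FiniteDimensional ℂ V] {p : ℍ} {F : Set ℍ}
    (hF : IsDirichletFundamentalSet Γ p F)
    (hfree : ∀ γ ∈ Γ, ∀ z : ℍ, γ • z = z → γ = 1 ∨ γ = -1)
    (hρ : ∀ γ : Γ, (γ : SL(2, ℝ)) = -1 → ρ γ = 1) {x : UnitTangent} (hx : x.pt ∈ F) {t : ℝ}
    {δ : Γ} (hδ : (δ • flow t x).pt ∈ F) {v : V} (hv : v ≠ 0) :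
    ‖ρ δ v‖ / ‖v‖ ≤ transportNorm Γ ρ (constNorm Γ ρ F) (QuotientTangent.mk Γ x) t := by
  have hnum (u : V) : constNorm Γ ρ F (FlatBundle.transport Γ ρ t (FlatBundle.mk Γ ρ x u)) =
      ‖ρ δ u‖ := by
    rw [FlatBundle.transport_mk, ← FlatBundle.mk_smul δ]
    exact constNorm_mk Γ ρ hF hfree hρ _ hδ _
  have hden (u : V) : constNorm Γ ρ F (FlatBundle.mk Γ ρ x u) = ‖u‖ :=
    constNorm_mk Γ ρ hF hfree hρ _ hx _
  -- A real `sSup` of an unbounded set would be `0`; finite dimension provides the upper bound.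
  refine le_csSup ⟨‖(ρ δ).toContinuousLinearMap‖, ?_⟩ ⟨FlatBundle.mk Γ ρ x v, rfl, ?_, ?_⟩
  · rintro _ ⟨e, he, -, rfl⟩
    obtain ⟨u, rfl⟩ := FlatBundle.exists_eq_mk he
    rw [hnum, hden]
    exact (ρ δ).toContinuousLinearMap.ratio_le_opNorm u
  · rw [hden]
    exact norm_ne_zero_iff.mpr hv
  · rw [hnum, hden]

lemma representation_zpow_apply {G : Type*} [Group G] {σ : Representation ℂ G V} {γ : G} {a : ℂ}
    {v : V} (ha : a ≠ 0) (hv : σ γ v = a • v) (n : ℤ) : σ (γ ^ n) v = a ^ n • v := by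
  have hinv : σ γ⁻¹ v = a⁻¹ • v := by
    rw [← inv_smul_smul₀ ha (σ γ⁻¹ v), ← map_smul, ← hv, ← Module.End.mul_apply, ← map_mul]
    simp
  induction n using Int.induction_on with
  | zero => simp
  | succ n ih =>
    rw [zpow_add_one, map_mul, Module.End.mul_apply, hv, map_smul, ih, smul_smul,
      zpow_add_one₀ ha, mul_comm]
  | pred n ih =>
    rw [zpow_sub_one, map_mul, Module.End.mul_apply, hinv, map_smul, ih, smul_smul,
      zpow_sub_one₀ ha, mul_comm]

lemma zpow_norm_le_transportNorm [FiniteDimensional ℂ V] {p : ℍ} {F : Set ℍ}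
    (hF : IsDirichletFundamentalSet Γ p F)
    (hfree : ∀ γ ∈ Γ, ∀ z : ℍ, γ • z = z → γ = 1 ∨ γ = -1)
    (hρ : ∀ γ : Γ, (γ : SL(2, ℝ)) = -1 → ρ γ = 1) {γ : Γ} {a : ℂ}
    (ha : Module.End.HasEigenvalue (ρ γ) a) (ha0 : a ≠ 0) {x : UnitTangent} (hx : x.pt ∈ F)
    {t : ℝ} {n : ℤ} (hn : ((γ ^ n) • flow t x).pt ∈ F) :
    ‖a‖ ^ n ≤ transportNorm Γ ρ (constNorm Γ ρ F) (QuotientTangent.mk Γ x) t := by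
  obtain ⟨v, hv⟩ := ha.exists_hasEigenvector
  have h1 := norm_div_norm_le_transportNorm hF hfree hρ hx hn hv.2
  rwa [representation_zpow_apply ha0 hv.apply_eq_smul, norm_smul, norm_zpow,
    mul_div_cancel_right₀ _ (norm_ne_zero_iff.mpr hv.2)] at h1

lemma eigenvalue_ne_zero {G : Type*} [Group G] {σ : Representation ℂ G V} {γ : G} {a : ℂ}
    (ha : Module.End.HasEigenvalue (σ γ) a) : a ≠ 0 := by
  rintro rfl
  obtain ⟨v, hv⟩ := ha.exists_hasEigenvector
  apply hv.2
  have h1 : σ γ⁻¹ (σ γ v) = v := by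
    rw [← Module.End.mul_apply, ← map_mul]
    simp
  rw [← h1, hv.apply_eq_smul]
  simp

/-- The unit tangent vectors whose image by `k` is based in the half-strip of half-width `ε`
about `Re z = b` above height `Y`, and makes an angle at most `π / 3` with the horizontal. -/
def cuspStrip (k : SL(2, ℝ)) (b ε Y : ℝ) : Set UnitTangent :=
  {x | |(k • x).pt.re - b| < ε ∧ Y < (k • x).pt.im ∧ (k • x).pt.im ≤ (k • x).vec.re}

lemma mem_of_strip_subset_dirichletDomain {p : ℍ} {F : Set ℍ}
    (hF : IsDirichletFundamentalSet Γ p F) {k : SL(2, ℝ)} {b ε Y : ℝ}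
    (hD : ∀ z : ℍ, |(k • z).re - b| < ε → Y < (k • z).im → z ∈ dirichletDomain Γ p)
    {z : ℍ} (h1 : |(k • z).re - b| < ε) (h2 : Y < (k • z).im) : z ∈ F := by
  refine hF.interior_subset (mem_interior.mpr
    ⟨{z | |(k • z).re - b| < ε ∧ Y < (k • z).im}, fun w hw => hD w hw.1 hw.2, ?_, h1, h2⟩)
  have hc : Continuous fun z : ℍ => k • z := continuous_const_smul k
  have hre := UpperHalfPlane.continuous_re.comp hc
  have him := UpperHalfPlane.continuous_im.comp hc
  exact (isOpen_lt (hre.sub continuous_const).abs continuous_const).inter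
    (isOpen_lt continuous_const him)

lemma exists_mul_im_le_iSup_posLog [FiniteDimensional ℂ V] {p : ℍ} {F : Set ℍ}
    (hF : IsDirichletFundamentalSet Γ p F)
    (hfree : ∀ γ ∈ Γ, ∀ z : ℍ, γ • z = z → γ = 1 ∨ γ = -1)
    (hρ : ∀ γ : Γ, (γ : SL(2, ℝ)) = -1 → ρ γ = 1) {γ : Γ} {a : ℂ}
    (ha : Module.End.HasEigenvalue (ρ γ) a) (ha1 : ‖a‖ ≠ 1) {k : SL(2, ℝ)} {h : ℝ} (hh : h ≠ 0)
    (hk : ∀ z : ℍ, k • (γ : SL(2, ℝ)) • z = h +ᵥ k • z) {b ε Y : ℝ} (hY : 0 < Y)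
    (hD : ∀ z : ℍ, |(k • z).re - b| < ε → Y < (k • z).im → z ∈ dirichletDomain Γ p) :
    ∃ C > 0, ∃ Y' ≥ Y, ∀ x ∈ cuspStrip k b ε Y', ENNReal.ofReal (C * (k • x).pt.im) ≤
      ⨆ t ∈ Set.Icc (-1 : ℝ) 1, ENNReal.ofReal (Real.posLog
        (transportNorm Γ ρ (constNorm Γ ρ F) (QuotientTangent.mk Γ x) t)) := by
  have ha0 := eigenvalue_ne_zero ha
  have hna := norm_pos_iff.mpr ha0
  have hτ := tanh_one_pos
  have hτ1 := Real.tanh_lt_one 1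
  have hh' := abs_pos.mpr hh
  have hlog : 0 < |Real.log ‖a‖| := abs_pos.mpr (Real.log_ne_zero_of_pos_of_ne_one hna ha1)
  set τ := Real.tanh 1
  have hκ : 0 < (1 - τ ^ 2) / 4 := by
    have : τ ^ 2 < 1 := by nlinarith
    linarith
  set κ := (1 - τ ^ 2) / 4 with hκdef
  -- Height above `Y / κ` keeps the geodesic above `Y` on `[-1, 1]`. Height above `8 * |h| / τ`
  -- makes `y * (τ / 4) / |h|` exceed `2`, so that its integer part is at least half of it.
  refine ⟨τ / (8 * |h|) * |Real.log ‖a‖|, by positivity,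
    max Y (max (Y / κ) (8 * |h| / τ)), le_max_left _ _, fun x hx => ?_⟩
  obtain ⟨hx1, hx2, hx3⟩ := hx
  simp only [max_lt_iff] at hx2
  obtain ⟨hx2, hx4, hx5⟩ := hx2
  set y := (k • x).pt.im with hy
  have hypos : 0 < y := hY.trans hx2
  set N : ℕ := ⌊y * (τ / 4) / |h|⌋₊ with hN
  have hN1 : (N : ℝ) * |h| ≤ y * (τ / 4) := by
    rw [← le_div_iff₀ hh']
    exact Nat.floor_le (by positivity)
  have hN2 : τ / (8 * |h|) * y ≤ N := by
    have h1 : y * (τ / 4) / |h| < N + 1 := Nat.lt_floor_add_one _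
    have h2 : 1 ≤ τ / (8 * |h|) * y := by
      rw [div_lt_iff₀ hτ] at hx5
      rw [div_mul_eq_mul_div, le_div_iff₀ (by positivity)]
      linarith
    have h3 : y * (τ / 4) / |h| = τ / (8 * |h|) * y * 2 := by
      field_simp
      norm_num
    linarith
  -- The sign of `m` treats `‖a‖ > 1` and `‖a‖ < 1` alike: the flow may move either way across the
  -- cusp.
  obtain ⟨m, hm1, hm2⟩ : ∃ m : ℤ, |(m : ℝ)| = N ∧ m * Real.log ‖a‖ = N * |Real.log ‖a‖| := by
    rcases abs_choice (Real.log ‖a‖) with e | e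
    · exact ⟨N, by simp, by rw [e]; push_cast; ring⟩
    · exact ⟨-N, by simp, by rw [e]; push_cast; ring⟩
  obtain ⟨t, ht, htre⟩ := exists_flow_pt_re_eq (x := k • x) hx3 (s := -(m * h)) (by
    rw [abs_neg, abs_mul, hm1]
    exact hN1)
  have hxF : x.pt ∈ F := mem_of_strip_subset_dirichletDomain hF hD hx1 hx2
  have hpt : k • ((γ ^ m) • flow t x).pt = ((m * h : ℝ) +ᵥ (flow t (k • x)).pt : ℍ) := by
    rw [flow_smul]
    exact smul_zpow_smul hk m _
  -- The geodesic moved by `-(m * h)`, so `γ ^ m` restores the initial real part and the point is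
  -- back in the strip.
  have hflowF : ((γ ^ m) • flow t x).pt ∈ F := by
    refine mem_of_strip_subset_dirichletDomain hF hD ?_ ?_
    · rw [hpt, UpperHalfPlane.vadd_re, htre, add_comm (m * h : ℝ), neg_add_cancel_right]
      exact hx1
    · rw [hpt, UpperHalfPlane.vadd_im]
      refine lt_of_lt_of_le ?_ (mul_sub_tanh_sq_le_flow_pt_im (k • x) ht)
      exact (div_lt_iff₀ hκ).mp hx4
  have hle := zpow_norm_le_transportNorm hF hfree hρ ha ha0 hxF hflowF
  refine le_iSup₂_of_le t ht (ENNReal.ofReal_le_ofReal ?_)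
  calc τ / (8 * |h|) * |Real.log ‖a‖| * y = τ / (8 * |h|) * y * |Real.log ‖a‖| := by ring
    _ ≤ N * |Real.log ‖a‖| := by gcongr
    _ = Real.log (‖a‖ ^ m) := by rw [Real.log_zpow, hm2]
    _ ≤ Real.log (transportNorm Γ ρ (constNorm Γ ρ F) (QuotientTangent.mk Γ x) t) :=
        Real.log_le_log (by positivity) hle
    _ ≤ _ := le_max_right _ _

end Transport

/-! ### Measurability and the divergent integral upstairs -/

lemma measurable_pt : Measurable UnitTangent.pt :=
  measurable_fst.comp (comap_measurable fun x : UnitTangent => (x.pt, x.vec))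

lemma measurable_vec : Measurable UnitTangent.vec :=
  measurable_snd.comp (comap_measurable fun x : UnitTangent => (x.pt, x.vec))

lemma measurable_smul_unitTangent (g : SL(2, ℝ)) : Measurable fun x : UnitTangent => g • x := by
  rw [measurable_comap_iff]
  refine Measurable.prodMk ((continuous_const_smul g).measurable.comp measurable_pt) ?_
  have hJ : Measurable (cocycle g) := by
    have := UpperHalfPlane.continuous_coe
    unfold cocycle
    fun_prop
  exact measurable_vec.div ((hJ.comp measurable_pt).pow_const 2)

lemma measurableSet_cuspStrip (k : SL(2, ℝ)) (b ε Y : ℝ) :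
    MeasurableSet (cuspStrip k b ε Y) := by
  have h1 := measurable_pt.comp (measurable_smul_unitTangent k)
  have h2 := measurable_vec.comp (measurable_smul_unitTangent k)
  have hre := UpperHalfPlane.continuous_re.measurable.comp h1
  have him := UpperHalfPlane.continuous_im.measurable.comp h1
  have habs : Measurable fun x : UnitTangent => |(k • x).pt.re - b| :=
    continuous_abs.measurable.comp (hre.sub_const b)
  exact (measurableSet_lt habs measurable_const).inter
    ((measurableSet_lt measurable_const him).inter
      (measurableSet_le him (Complex.measurable_re.comp h2)))

lemma measurable_im_smul_pt (k : SL(2, ℝ)) (C : ℝ) :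
    Measurable fun x : UnitTangent => ENNReal.ofReal (C * (k • x).pt.im) :=
  ENNReal.measurable_ofReal.comp ((UpperHalfPlane.continuous_im.measurable.comp
    (measurable_pt.comp (measurable_smul_unitTangent k))).const_mul C)

/-- Möbius maps are conformal: on the circle of directions at `z`, `k` acts as a rotation by an
angle `ψ`, independent of `θ`. -/
lemma smul_ofAngle_vec_re (k : SL(2, ℝ)) (z : ℍ) : ∃ ψ ∈ Set.Ioc (-Real.pi) Real.pi, ∀ θ : ℝ,
    (k • ofAngle (z, θ)).vec.re = 2 * (k • z).im * Real.cos (θ + ψ) := by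
  set u := (k • ofAngle (z, 0)).vec with hu
  refine ⟨Complex.arg u, Complex.arg_mem_Ioc u, fun θ => ?_⟩
  have h1 : (k • ofAngle (z, θ)).vec = u * Complex.exp (θ * Complex.I) := by
    rw [hu, smul_vec, smul_vec]
    change 2 * (z.im : ℂ) * Complex.exp (θ * Complex.I) / cocycle k z ^ 2 =
      2 * (z.im : ℂ) * Complex.exp ((0 : ℝ) * Complex.I) / cocycle k z ^ 2 * _
    simp only [Complex.ofReal_zero, zero_mul, Complex.exp_zero]
    ring
  have h2 : ‖u‖ = 2 * (k • z).im := (k • ofAngle (z, 0)).norm_vec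
  have h3 := Complex.norm_mul_exp_arg_mul_I u
  set ψ := Complex.arg u
  rw [h1, ← h3, mul_assoc, ← Complex.exp_add, ← add_mul, h2,
    Complex.re_ofReal_mul, ← Complex.ofReal_add, Complex.exp_ofReal_mul_I_re, add_comm]

lemma volume_half_le_cos_add {ψ : ℝ} (hψ : ψ ∈ Set.Ioc (-Real.pi) Real.pi) :
    ENNReal.ofReal (Real.pi / 3) ≤
      (volume.restrict (Set.Ioc (-Real.pi) Real.pi)) {θ | 1 / 2 ≤ Real.cos (θ + ψ)} := by
  have hπ := Real.pi_pos
  have hcos {θ : ℝ} (h : |θ + ψ| ≤ Real.pi / 3) : 1 / 2 ≤ Real.cos (θ + ψ) := by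
    rw [← Real.cos_pi_div_three, ← Real.cos_abs (θ + ψ)]
    exact Real.cos_le_cos_of_nonneg_of_le_pi (abs_nonneg _) (by linarith) h
  -- Only half of the arc `|θ + ψ| ≤ π / 3` is kept, on the side chosen by the sign of `ψ`, so that
  -- it does not leave `(-π, π]`.
  obtain ⟨l, hl⟩ : ∃ l : ℝ, Set.Ioo l (l + Real.pi / 3) ⊆
      {θ | 1 / 2 ≤ Real.cos (θ + ψ)} ∩ Set.Ioc (-Real.pi) Real.pi := by
    rcases le_total 0 ψ with h | h
    · refine ⟨-ψ, fun θ hθ => ⟨hcos (abs_le.mpr ⟨?_, ?_⟩), ?_, ?_⟩⟩ <;>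
        linarith [hθ.1, hθ.2, hψ.1, hψ.2]
    · refine ⟨-ψ - Real.pi / 3, fun θ hθ => ⟨hcos (abs_le.mpr ⟨?_, ?_⟩), ?_, ?_⟩⟩ <;>
        linarith [hθ.1, hθ.2, hψ.1, hψ.2]
  calc ENNReal.ofReal (Real.pi / 3) = volume (Set.Ioo l (l + Real.pi / 3)) := by simp
    _ ≤ _ := measure_mono hl
    _ ≤ _ := Measure.le_restrict_apply _ _

lemma setLIntegral_Ioi_const_div (C Y : ℝ) (hC : 0 < C) (hY : 0 < Y) :
    ∫⁻ y in Set.Ioi Y, ENNReal.ofReal (C / y) = ∞ := by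
  by_contra hne
  refine not_integrableOn_Ioi_inv (a := Y) ?_
  have hi : IntegrableOn (fun y : ℝ => C / y) (Set.Ioi Y) := by
    refine ⟨by fun_prop, ?_⟩
    rw [hasFiniteIntegral_iff_ofReal]
    · exact lt_top_iff_ne_top.mpr hne
    · filter_upwards [ae_restrict_mem measurableSet_Ioi] with y hy
      have : 0 < y := hY.trans hy
      positivity
  have h1 : IntegrableOn (fun y : ℝ => C⁻¹ * (C / y)) (Set.Ioi Y) := hi.const_mul C⁻¹
  refine IntegrableOn.congr_fun h1 (fun y _ => ?_) measurableSet_Ioi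
  field_simp

/-- The half-strip of half-width `ε` about `Re z = b` above height `Y`. -/
def halfStrip (b ε Y : ℝ) : Set ℍ := {z | |z.re - b| < ε ∧ Y < z.im}

lemma measurableSet_halfStrip (b ε Y : ℝ) : MeasurableSet (halfStrip b ε Y) :=
  ((isOpen_lt (UpperHalfPlane.continuous_re.sub continuous_const).abs continuous_const).inter
    (isOpen_lt continuous_const UpperHalfPlane.continuous_im)).measurableSet

/-- Against the density `1 / y ^ 2`, the height leaves `C / y`; by Fubini the integral is the width
`2 * ε` times a divergent one. -/
lemma setLIntegral_halfStrip_im {b ε Y C : ℝ} (hε : 0 < ε) (hY : 0 < Y) (hC : 0 < C) :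
    ∫⁻ z in halfStrip b ε Y, ENNReal.ofReal (C * z.im) = ∞ := by
  have him : Measurable fun z : ℍ => NNReal.mk z.im z.im_pos.le :=
    UpperHalfPlane.continuous_im.measurable.subtype_mk
  have hdens : Measurable fun z : ℍ => ((1 / NNReal.mk z.im z.im_pos.le : NNReal) ^ 2 : NNReal) :=
    (him.const_div 1).pow_const 2
  have hS := measurableSet_halfStrip b ε Y
  rw [UpperHalfPlane.volume_def, restrict_withDensity hS,
    lintegral_withDensity_eq_lintegral_mul _ hdens.coe_nnreal_ennreal
    (g := fun z : ℍ => ENNReal.ofReal (C * z.im))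
    (ENNReal.measurable_ofReal.comp (UpperHalfPlane.continuous_im.measurable.const_mul C))]
  have hR : MeasurePreserving UpperHalfPlane.coe (volume.comap UpperHalfPlane.coe)
      (volume.restrict (.range UpperHalfPlane.coe)) :=
    ⟨UpperHalfPlane.measurable_coe, by rw [UpperHalfPlane.measurableEmbedding_coe.map_comap]⟩
  have himg : UpperHalfPlane.coe '' halfStrip b ε Y =
      Complex.measurableEquivRealProd ⁻¹' (Set.Ioo (b - ε) (b + ε) ×ˢ Set.Ioi Y) := by
    ext w
    constructor
    · rintro ⟨z, ⟨h1, h2⟩, rfl⟩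
      rw [abs_lt] at h1
      exact ⟨⟨by change b - ε < z.re; linarith, by change z.re < b + ε; linarith⟩, h2⟩
    · rintro ⟨⟨h1, h2⟩, h3⟩
      refine ⟨⟨w, hY.trans h3⟩, ⟨abs_lt.mpr ⟨?_, ?_⟩, h3⟩, rfl⟩
      · change -ε < w.re - b
        have : b - ε < w.re := h1
        linarith
      · change w.re - b < ε
        have : w.re < b + ε := h2
        linarith
  calc _ = ∫⁻ z in halfStrip b ε Y, ENNReal.ofReal (C / (z : ℂ).im)
        ∂(volume.comap UpperHalfPlane.coe) := by
        refine lintegral_congr fun z => ?_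
        have hz := z.im_pos
        rw [Pi.mul_apply, ← ENNReal.ofReal_coe_nnreal,
          ← ENNReal.ofReal_mul (NNReal.coe_nonneg _)]
        congr 1
        push_cast
        change (1 / z.im) ^ 2 * (C * z.im) = C / z.im
        field_simp
    _ = ∫⁻ w in UpperHalfPlane.coe '' halfStrip b ε Y, ENNReal.ofReal (C / w.im)
        ∂(volume.restrict (.range UpperHalfPlane.coe)) :=
        hR.setLIntegral_comp_emb UpperHalfPlane.measurableEmbedding_coe
          (fun w : ℂ => ENNReal.ofReal (C / w.im)) _
    _ = ∫⁻ w in UpperHalfPlane.coe '' halfStrip b ε Y, ENNReal.ofReal (C / w.im) := by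
        rw [Measure.restrict_restrict
          (UpperHalfPlane.measurableEmbedding_coe.measurableSet_image.mpr hS),
          Set.inter_eq_self_of_subset_left (Set.image_subset_range _ _)]
    _ = ∫⁻ q in Set.Ioo (b - ε) (b + ε) ×ˢ Set.Ioi Y, ENNReal.ofReal (C / q.2) := by
        rw [himg]
        exact Complex.volume_preserving_equiv_real_prod.setLIntegral_comp_preimage_emb
          Complex.measurableEquivRealProd.measurableEmbedding
          (fun q : ℝ × ℝ => ENNReal.ofReal (C / q.2)) _
    _ = ∞ := by
        rw [Measure.volume_eq_prod, setLIntegral_prod _ (by fun_prop)]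
        simp only [setLIntegral_Ioi_const_div C Y hC hY]
        simp [hε]

lemma lintegral_comp_smul (k : SL(2, ℝ)) (f : ℍ → ℝ≥0∞) (hf : Measurable f) :
    ∫⁻ z, f (k • z) = ∫⁻ z, f z :=
  (measurePreserving_smul (k : GL (Fin 2) ℝ) (volume : Measure ℍ)).lintegral_comp hf

/-- Over each base point of the strip the admissible directions have angular measure at least `π /
3`. Invariance of the area under `k` then reduces the claim to `setLIntegral_halfStrip_im`. -/
lemma setLIntegral_cuspStrip_im (k : SL(2, ℝ)) {b ε Y C : ℝ} (hε : 0 < ε) (hY : 0 < Y)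
    (hC : 0 < C) :
    ∫⁻ x in cuspStrip k b ε Y, ENNReal.ofReal (C * (k • x).pt.im) ∂liouville = ∞ := by
  have hS := measurableSet_cuspStrip k b ε Y
  have hmeas := (measurable_im_smul_pt k C).indicator hS
  set f : ℍ → ℝ≥0∞ := (halfStrip b ε Y).indicator fun z => ENNReal.ofReal (C * z.im) with hf
  have hfm : Measurable f := (ENNReal.measurable_ofReal.comp
    (UpperHalfPlane.continuous_im.measurable.const_mul C)).indicator
      (measurableSet_halfStrip b ε Y)
  have hkm : Measurable fun z : ℍ => k • z := (continuous_const_smul k).measurable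
  rw [← lintegral_indicator hS, liouville, lintegral_map hmeas measurable_ofAngle,
    lintegral_prod (fun q => (cuspStrip k b ε Y).indicator
      (fun x => ENNReal.ofReal (C * (k • x).pt.im)) (ofAngle q))
      (hmeas.comp measurable_ofAngle).aemeasurable, eq_top_iff]
  calc ∞ = (1 / 4 : ℝ≥0∞) * ((∫⁻ z, f z) * ENNReal.ofReal (Real.pi / 3)) := by
        rw [hf, lintegral_indicator (measurableSet_halfStrip b ε Y),
          setLIntegral_halfStrip_im hε hY hC, ENNReal.top_mul, ENNReal.mul_top]
        · simp
        · simpa using Real.pi_pos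
    _ = ∫⁻ z, f (k • z) * ENNReal.ofReal (Real.pi / 3) ∂hypArea := by
        rw [hypArea, lintegral_smul_measure, lintegral_mul_const (f := fun z => f (k • z)) _
          (hfm.comp hkm),
          lintegral_comp_smul k f hfm, smul_eq_mul]
    _ ≤ _ := by
        refine lintegral_mono fun z => ?_
        obtain ⟨ψ, hψ, hre⟩ := smul_ofAngle_vec_re k z
        have hA : MeasurableSet {θ : ℝ | 1 / 2 ≤ Real.cos (θ + ψ)} :=
          (isClosed_le continuous_const (by fun_prop)).measurableSet
        calc f (k • z) * ENNReal.ofReal (Real.pi / 3)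
            ≤ f (k • z) * (volume.restrict (Set.Ioc (-Real.pi) Real.pi))
                {θ | 1 / 2 ≤ Real.cos (θ + ψ)} := by
              gcongr
              exact volume_half_le_cos_add hψ
          _ = ∫⁻ θ in Set.Ioc (-Real.pi) Real.pi,
                {θ | 1 / 2 ≤ Real.cos (θ + ψ)}.indicator (fun _ => f (k • z)) θ :=
              (lintegral_indicator_const hA _).symm
          _ ≤ _ := by
              refine lintegral_mono fun θ => ?_
              refine Set.indicator_apply_le' (fun hθ => ?_) fun _ => zero_le
              by_cases hz : k • z ∈ halfStrip b ε Y
              · have hmem : ofAngle (z, θ) ∈ cuspStrip k b ε Y := by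
                  refine ⟨hz.1, hz.2, ?_⟩
                  rw [hre]
                  have h1 : 1 / 2 ≤ Real.cos (θ + ψ) := hθ
                  have h2 := (k • z).im_pos
                  change (k • z).im ≤ _
                  nlinarith
                rw [hf, Set.indicator_of_mem hz, Set.indicator_of_mem hmem]
                rfl
              · rw [hf, Set.indicator_of_notMem hz]
                exact zero_le

/-! ### Descent to the quotient -/

lemma isClosed_dirichletDomain (Γ : Subgroup SL(2, ℝ)) (p : ℍ) :
    IsClosed (dirichletDomain Γ p) := by
  simp only [dirichletDomain, Set.ofPred_forall]
  exact isClosed_biInter fun γ _ => isClosed_le (by fun_prop) (by fun_prop)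

lemma liouville_tangentDomain_lt_top {Γ : Subgroup SL(2, ℝ)} {p : ℍ}
    (harea : hypArea (dirichletDomain Γ p) < ∞) : liouville (tangentDomain Γ p) < ∞ := by
  have hT : MeasurableSet (tangentDomain Γ p) :=
    measurable_pt (isClosed_dirichletDomain Γ p).measurableSet
  have hpre : ofAngle ⁻¹' tangentDomain Γ p = dirichletDomain Γ p ×ˢ Set.univ := by
    ext q
    simp [tangentDomain, ofAngle]
  have : SFinite hypArea := by
    unfold hypArea
    infer_instance
  rw [liouville, Measure.map_apply measurable_ofAngle hT, hpre, Measure.prod_prod]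
  exact ENNReal.mul_lt_top harea (measure_lt_top _ _)

/-- Makes `fibreSup` a countable supremum, hence measurable. -/
lemma countable_of_discreteTopology (Γ : Subgroup SL(2, ℝ)) [DiscreteTopology Γ] :
    Countable Γ := by
  have : SecondCountableTopology (Matrix (Fin 2) (Fin 2) ℝ) :=
    inferInstanceAs (SecondCountableTopology (Fin 2 → Fin 2 → ℝ))
  have : SecondCountableTopology SL(2, ℝ) :=
    Matrix.SpecialLinearGroup.isClosedEmbedding_val.isEmbedding.secondCountableTopology
  exact TopologicalSpace.separableSpace_iff_countable.mp inferInstance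

section Quotient

variable (Γ : Subgroup SL(2, ℝ))

/-- The supremum of a function on `T¹ℍ` along the fibres of the projection to `T¹C`. -/
noncomputable def fibreSup (G : UnitTangent → ℝ≥0∞) : QuotientTangent Γ → ℝ≥0∞ :=
  Quotient.lift (fun x => ⨆ δ : Γ, G (δ • x)) (by
    rintro a b ⟨γ, rfl⟩
    simp only [smul_smul]
    exact (Equiv.mulRight γ).iSup_comp (g := fun δ : Γ => G (δ • b)))

lemma measurable_fibreSup [DiscreteTopology Γ] {G : UnitTangent → ℝ≥0∞} (hG : Measurable G) :
    Measurable (fibreSup Γ G) := by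
  have := countable_of_discreteTopology Γ
  refine measurable_from_quotient.mpr ?_
  exact Measurable.iSup fun δ : Γ => hG.comp (measurable_smul_unitTangent δ)

lemma le_fibreSup_mk (G : UnitTangent → ℝ≥0∞) (x : UnitTangent) :
    G x ≤ fibreSup Γ G (QuotientTangent.mk Γ x) :=
  le_iSup_of_le (f := fun δ : Γ => G (δ • x)) 1 (by rw [one_smul])

lemma fibreSup_le {G : UnitTangent → ℝ≥0∞} {f : QuotientTangent Γ → ℝ≥0∞}
    (h : ∀ x, G x ≤ f (QuotientTangent.mk Γ x)) (q : QuotientTangent Γ) :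
    fibreSup Γ G q ≤ f q := by
  induction q using Quotient.inductionOn with
  | h x =>
    refine iSup_le fun δ : Γ => (h (δ • x)).trans_eq (congrArg f ?_)
    exact Quotient.sound (s := MulAction.orbitRel Γ UnitTangent) ⟨δ, rfl⟩

/-- Since `f` is not assumed measurable, its integral against a pushforward cannot be computed
directly. The fibrewise supremum of `S.indicator G` is a measurable minorant of `f` whose pullback
dominates `G` on `S`. -/
lemma lintegral_flowMeasure_eq_top [DiscreteTopology Γ] {p : ℍ}
    (harea : hypArea (dirichletDomain Γ p) < ∞) {S : Set UnitTangent} (hS : MeasurableSet S)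
    (hSD : S ⊆ tangentDomain Γ p) {G : UnitTangent → ℝ≥0∞} (hG : Measurable G)
    (hint : ∫⁻ x in S, G x ∂liouville = ∞) {f : QuotientTangent Γ → ℝ≥0∞}
    (h : ∀ x ∈ S, G x ≤ f (QuotientTangent.mk Γ x)) : ∫⁻ q, f q ∂(flowMeasure Γ p) = ∞ := by
  have hm := hG.indicator hS
  rw [eq_top_iff]
  calc ∞ = (liouville (tangentDomain Γ p))⁻¹ * ∫⁻ x in S, G x ∂liouville := by
        rw [hint, ENNReal.mul_top]
        -- Finite area enters here: the normalising factor is nonzero, so the product stays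
        -- infinite.
        exact ENNReal.inv_ne_zero.mpr (liouville_tangentDomain_lt_top harea).ne
    _ ≤ (liouville (tangentDomain Γ p))⁻¹ *
        ∫⁻ x in tangentDomain Γ p, fibreSup Γ (S.indicator G) (QuotientTangent.mk Γ x)
          ∂liouville := by
        refine mul_le_mul_right ?_ _
        calc ∫⁻ x in S, G x ∂liouville
            = ∫⁻ x in tangentDomain Γ p, S.indicator G x ∂liouville := by
              rw [lintegral_indicator hS, Measure.restrict_restrict hS,
                Set.inter_eq_self_of_subset_left hSD]
          _ ≤ _ := lintegral_mono fun x => le_fibreSup_mk Γ _ x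
    _ = ∫⁻ q, fibreSup Γ (S.indicator G) q ∂(flowMeasure Γ p) := by
        rw [flowMeasure, lintegral_smul_measure, smul_eq_mul,
          lintegral_map (measurable_fibreSup Γ hm) (QuotientTangent.measurable_mk Γ)]
    _ ≤ _ := lintegral_mono (fibreSup_le Γ fun x => Set.indicator_le h x)

end Quotient

lemma hasEigenvalue_conj {V : Type*} [AddCommGroup V] [Module ℂ V] {G : Type*} [Group G]
    {σ : Representation ℂ G V} {γ δ : G} {a : ℂ} (ha : Module.End.HasEigenvalue (σ γ) a) :
    Module.End.HasEigenvalue (σ (δ⁻¹ * γ * δ)) a := by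
  obtain ⟨v, hv⟩ := ha.exists_hasEigenvector
  have hinv (u : V) : σ δ (σ δ⁻¹ u) = u := by
    rw [← Module.End.mul_apply, ← map_mul]
    simp
  refine Module.End.hasEigenvalue_of_hasEigenvector (x := σ δ⁻¹ v)
    (Module.End.hasEigenvector_iff.mpr ⟨Module.End.mem_eigenspace_iff.mpr ?_, fun h0 => hv.2 ?_⟩)
  · rw [map_mul, map_mul, Module.End.mul_apply, Module.End.mul_apply, hinv, hv.apply_eq_smul,
      map_smul]
  · rw [← hinv v, h0, map_zero]

end GeodesicCocycle

theorem mainTheorem11 {V : Type*} [NormedAddCommGroup V] [NormedSpace ℂ V]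
    [FiniteDimensional ℂ V]
    (Γ : Subgroup SL(2, ℝ)) [DiscreteTopology Γ]
    (hfree : ∀ γ ∈ Γ, ∀ z : ℍ, γ • z = z → γ = 1 ∨ γ = -1)
    (ρ : Representation ℂ Γ V)
    (hρ : ∀ γ : Γ, (γ : SL(2, ℝ)) = -1 → ρ γ = 1)
    (p : ℍ) (harea : hypArea (dirichletDomain Γ p) < ∞)
    (F : Set ℍ) (hF : IsDirichletFundamentalSet Γ p F)
    (c : OnePoint ℝ) (γ : Γ) (hγ : IsSimpleCuspLoop Γ c γ)
    (a : ℂ) (ha : Module.End.HasEigenvalue (ρ γ) a) (ha1 : ‖a‖ ≠ 1) :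
    ¬ IsIntegrableFlatBundle Γ ρ (constNorm Γ ρ F) (flowMeasure Γ p) := by
  obtain ⟨k₀, h, hh, hk₀⟩ := exists_conj_eq_vadd hγ.isParabolic hγ.smul_eq
  obtain ⟨δ₀, hδ₀⟩ := exists_forall_im_orbit_le hk₀ hh p
  -- Instead of moving `p` to the highest orbit point `δ₀ • p`, the loop is conjugated by `δ₀` and
  -- the coordinate becomes `k₀ * δ₀`. The domain stays centred at `p`, and the conjugate monodromy
  -- keeps the eigenvalue `a`.
  have hk (z : ℍ) : (k₀ * δ₀) • ((δ₀⁻¹ * γ * δ₀ : Γ) : SL(2, ℝ)) • z =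
      h +ᵥ (k₀ * (δ₀ : SL(2, ℝ))) • z := by
    rw [mul_smul, mul_smul, ← hk₀]
    simp [mul_smul]
  have hmax (δ : Γ) : ((k₀ * (δ₀ : SL(2, ℝ))) • δ • p).im ≤ ((k₀ * (δ₀ : SL(2, ℝ))) • p).im := by
    rw [mul_smul, mul_smul]
    have := hδ₀ (δ₀ * δ)
    rw [mul_smul] at this
    exact this
  obtain ⟨ε, hε, Y, hY, hD⟩ := exists_strip_subset_dirichletDomain hmax
  have ha' : Module.End.HasEigenvalue (ρ (δ₀⁻¹ * γ * δ₀)) a := hasEigenvalue_conj ha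
  obtain ⟨C, hC, Y', hY', hle⟩ :=
    exists_mul_im_le_iSup_posLog hF hfree hρ ha' ha1 hh hk hY hD
  rw [IsIntegrableFlatBundle, lintegral_flowMeasure_eq_top Γ harea
    (measurableSet_cuspStrip _ _ _ _) (fun x hx => hD x.pt hx.1 (hY'.trans_lt hx.2.1))
    (measurable_im_smul_pt _ C) (setLIntegral_cuspStrip_im _ hε (hY.trans_le hY') hC) hle]
  exact lt_irrefl _
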